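/- **Opportunistic bandit with random binary load.** Let $K\ge 1$, $\epsilon_0,\epsilon_1\in[0,\tfrac12)$ and $\rho\in(0,1)$. In each slot $t=1,2,\dots$ there is a load $L_t\in\{\epsilon_0,1-\epsilon_1\}$ with $\mathbb P\{L_t=\epsilon_0\}=\rho$, and each arm $k\in\{1,\dots,K\}$ has a nominal reward $X_{k,t}\in[0,1]$ with mean $u_k$; for each $k$ the $X_{k,t}$ are identically distributed over $t$, and all loads and all nominal rewards are mutually independent. There is a unique best arm, say arm $1$, and $\Delta_k=u_1-u_k>0$ for $k>1$. In slot $t$ an agent pulls an arm $a_t$ which is a (measurable) function of $L_t$ and of the history $(L_\tau,a_\tau,X_{a_\tau,\tau})_{\tau<t}$; it receives the actual reward $L_tX_{a_t,t}$ and observes $X_{a_t,t}$. The regret after $T$ slots is $$R(T)=u_1\,\mathbb E\Big[\sum_{t=1}^T L_t\Big]-\sum_{t=1}^T\mathbb E[L_tX_{a_t,t}].$$ **AdaUCB** with parameter $\alpha$ and truncation thresholds $l^{(-)}=\epsilon_0$, $l^{(+)}=1$ pulls each arm once in the slots $1,\dots,K$ and, in each slot $t>K$, pulls an arm $a_t$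 maximizing $$\hat u_k(t)=\bar u_k(t)+\sqrt{\frac{\alpha(1-\tilde L_t)\log t}{C_k(t-1)}},\qquad \tilde L_t=\frac{\max\{l^{(-)},\min(L_t,l^{(+)})\}-l^{(-)}}{l^{(+)}-l^{(-)}},$$ where $C_k(t-1)$ is the number of pulls of arm $k$ before slot $t$ and $\bar u_k(t)$ is the average of the nominal rewards observed in these pulls (ties are broken arbitrarily). Thus $1-\tilde L_t=1$ if $L_t=\epsilon_0$, and $1-\tilde L_t=\frac{\epsilon_1}{1-\epsilon_0}$ if $L_t=1-\epsilon_1$. **Theorem.** If $\alpha>16$ and $\sqrt{\frac{\epsilon_1}{1-\epsilon_0}}<\frac18$, then the regret of AdaUCB satisfies $$R_{\mathrm{AdaUCB}}(T)\le 4\epsilon_0\alpha\log T\sum_{k>1}\frac1{\Delta_k}+O(1),$$ that is, there is a constant $C$, depending only on $K,\alpha,\epsilon_0,\epsilon_1,\rho$ and the gaps $(\Delta_k)_{k>1}$, such that $R_{\mathrm{AdaUCB}}(T)\le 4\epsilon_0\alpha\log T\sum_{k>1}\frac1{\Delta_k}+C$ for all $T\ge1$. -/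

import Mathlib

open MeasureTheory ProbabilityTheory

namespace AdaUCB

/-- What the agent records in one slot: the load, the arm it pulled, and the nominal reward of
that arm. -/
abbrev Obs (K : ℕ) : Type := ℝ × Fin K × ℝ

/-- A (deterministic, causal) policy. Slots are numbered from `0`, so slot `n` here is the slot
`t = n + 1` in the usual numbering. In slot `n` the policy chooses an arm from the current load
and the history of the `n` previous slots. -/
abbrev Policy (K : ℕ) : Type := (n : ℕ) → ℝ → (Fin n → Obs K) → Fin K

section Play

variable {K : ℕ}

/-- The history of the first `n` slots when `Γ` is run against the load sequence `l` and the
nominal rewards `x` (`x k n` is the nominal reward of arm `k` in slot `n`). -/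
def history (Γ : Policy K) (l : ℕ → ℝ) (x : Fin K → ℕ → ℝ) : (n : ℕ) → Fin n → Obs K
  | 0 => fun i => i.elim0
  | n + 1 =>
      Fin.snoc (α := fun _ => Obs K) (history Γ l x n)
        (l n, Γ n (l n) (history Γ l x n), x (Γ n (l n) (history Γ l x n)) n)

/-- The arm pulled by `Γ` in slot `n`. -/
def action (Γ : Policy K) (l : ℕ → ℝ) (x : Fin K → ℕ → ℝ) (n : ℕ) : Fin K :=
  Γ n (l n) (history Γ l x n)

/-- The number of pulls of arm `k` in a history. -/
def pulls {n : ℕ} (h : Fin n → Obs K) (k : Fin K) : ℕ :=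
  (Finset.univ.filter fun s => (h s).2.1 = k).card

/-- The empirical mean of the nominal rewards of arm `k` in a history
(with the initial value `1` as long as the arm has not been pulled). -/
noncomputable def empMean {n : ℕ} (h : Fin n → Obs K) (k : Fin K) : ℝ :=
  if pulls h k = 0 then 1
  else (∑ s : Fin n, if (h s).2.1 = k then (h s).2.2 else 0) / (pulls h k : ℝ)

/-- The load, truncated to `[lo, hi]` and normalized to `[0, 1]`. -/
noncomputable def normLoad (lo hi l : ℝ) : ℝ :=
  (max lo (min l hi) - lo) / (hi - lo)

/-- The AdaUCB index of arm `k` in slot `n` (that is, at time `t = n + 1`), under the load `l` and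
after the history `h` of the `n` previous slots. -/
noncomputable def index (α lo hi : ℝ) {n : ℕ} (l : ℝ) (h : Fin n → Obs K) (k : Fin K) : ℝ :=
  empMean h k +
    √(α * (1 - normLoad lo hi l) * Real.log ((n : ℝ) + 1) / (pulls h k : ℝ))

/-- `Γ` is an implementation of AdaUCB with parameter `α` and truncation thresholds `lo`, `hi`:
the first `K` slots pull each arm once (in any order), and every later slot pulls an arm with the
largest index (ties being broken in any measurable way from the current load and the history). -/
structure IsAdaUCB (α lo hi : ℝ) (Γ : Policy K) : Prop where
  measurable : ∀ n, Measurable fun p : ℝ × (Fin n → Obs K) => Γ n p.1 p.2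
  init : ∀ n, n < K → ∀ (l : ℝ) (h : Fin n → Obs K), pulls h (Γ n l h) = 0
  argmax : ∀ n, K ≤ n → ∀ (l : ℝ) (h : Fin n → Obs K) (k : Fin K),
    index α lo hi l h k ≤ index α lo hi l h (Γ n l h)

variable {Ω : Type*} [MeasurableSpace Ω]

/-- The opportunistic bandit with i.i.d. binary-valued load and random rewards: `L n` is the load
in slot `n`, `X k n` is the nominal reward of arm `k` in slot `n`, and `u k` is its mean. -/
structure BinaryLoadBandit (μ : Measure Ω) (L : ℕ → Ω → ℝ) (X : Fin K → ℕ → Ω → ℝ)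
    (ε₀ ε₁ ρ : ℝ) (u : Fin K → ℝ) : Prop where
  measurable_load : ∀ n, Measurable (L n)
  measurable_reward : ∀ k n, Measurable (X k n)
  load_mem : ∀ n, ∀ᵐ ω ∂μ, L n ω = ε₀ ∨ L n ω = 1 - ε₁
  load_prob : ∀ n, μ {ω | L n ω = ε₀} = ENNReal.ofReal ρ
  reward_mem : ∀ k n, ∀ᵐ ω ∂μ, X k n ω ∈ Set.Icc (0 : ℝ) 1
  reward_identDistrib : ∀ k n, IdentDistrib (X k n) (X k 0) μ μ
  reward_mean : ∀ k n, ∫ ω, X k n ω ∂μ = u k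
  /-- all loads and all nominal rewards are mutually independent -/
  indep : iIndepFun (Sum.elim L fun p : Fin K × ℕ => X p.1 p.2) μ

/-- The regret of `Γ` over `T` slots: the expected actual reward of always pulling the best arm
minus the expected actual reward of `Γ`. -/
noncomputable def regret (μ : Measure Ω) (L : ℕ → Ω → ℝ) (X : Fin K → ℕ → Ω → ℝ)
    (u : Fin K → ℝ) (Γ : Policy K) (T : ℕ) : ℝ :=
  (⨆ k, u k) * (∫ ω, ∑ n ∈ Finset.range T, L n ω ∂μ) -
    ∑ n ∈ Finset.range T,
      ∫ ω, L n ω * X (action Γ (fun m => L m ω) (fun k m => X k m ω) n) n ω ∂μ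

end Play

end AdaUCB

/-! The regret is the expected sum of load times gap, so it suffices to bound, path by path, the
load spent on each suboptimal arm `k`, with gap D. Outside an atypical event, a late pull of `k`
happens only at low load and only while `k` has fewer than 4α log(n+1)/D² pulls
(`IsAdaUCB.low_and_pulls_lt`). Such slots cost ε₀ each, and weighting them by D gives the main term.

High load is harmless because low load has already explored enough. The second half of the past
holds linearly many low-load slots, so by pigeonhole one of them chose an arm with a tiny bonus.
That arm won against full bonuses, which bounds the bonus of every arm by a multiple of its own gap
plus a small multiple of D. At high load the bonuses shrink by a factor below 1/8, too little to
lift `k` above the best arm.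

A slot is atypical if some empirical mean is off by more than about a quarter of its bonus, or if
low loads were scarce. The first is controlled, despite adaptive sampling, by an exponential
supermartingale over the first `m` pulls (`lintegral_prod_selected_le_one`) and a union over `m`;
the second by Hoeffding's inequality. For α > 16 these probabilities are summable, so early and
atypical slots contribute O(1). -/

namespace AdaUCB

/-! ### Deterministic analysis of a single trajectory. -/

section Path

variable {K : ℕ} (Γ : Policy K) (l : ℕ → ℝ) (x : Fin K → ℕ → ℝ)

/-- The sum of the nominal rewards of arm `k` in a history. -/
noncomputable def rewardSum {n : ℕ} (h : Fin n → Obs K) (k : Fin K) : ℝ :=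
  ∑ s : Fin n, if (h s).2.1 = k then (h s).2.2 else 0

theorem pulls_eq_sum {n : ℕ} (h : Fin n → Obs K) (k : Fin K) :
    pulls h k = ∑ s : Fin n, if (h s).2.1 = k then 1 else 0 := by
  rw [pulls, Finset.card_filter]

theorem history_succ (n : ℕ) :
    history Γ l x (n + 1) = Fin.snoc (α := fun _ => Obs K) (history Γ l x n)
      (l n, action Γ l x n, x (action Γ l x n) n) :=
  rfl

theorem pulls_history_succ (k : Fin K) (n : ℕ) :
    pulls (history Γ l x (n + 1)) k =
      pulls (history Γ l x n) k + if action Γ l x n = k then 1 else 0 := by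
  rw [pulls_eq_sum, pulls_eq_sum, Fin.sum_univ_castSucc]
  simp [history_succ]

theorem rewardSum_history_succ (k : Fin K) (n : ℕ) :
    rewardSum (history Γ l x (n + 1)) k =
      rewardSum (history Γ l x n) k + if action Γ l x n = k then x k n else 0 := by
  rw [rewardSum, rewardSum, Fin.sum_univ_castSucc]
  simp only [history_succ, Fin.snoc_castSucc, Fin.snoc_last]
  congr 1
  split_ifs with h
  · rw [h]
  · rfl

theorem pulls_history_eq_sum (k : Fin K) (n : ℕ) :
    pulls (history Γ l x n) k =
      ∑ s ∈ Finset.range n, if action Γ l x s = k then 1 else 0 := by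
  induction n with
  | zero => simp [pulls]
  | succ n ih => rw [pulls_history_succ, ih, Finset.sum_range_succ]

theorem rewardSum_history_eq_sum (k : Fin K) (n : ℕ) :
    rewardSum (history Γ l x n) k =
      ∑ s ∈ Finset.range n, if action Γ l x s = k then x k s else 0 := by
  induction n with
  | zero => simp [rewardSum]
  | succ n ih => rw [rewardSum_history_succ, ih, Finset.sum_range_succ]

theorem pulls_history_mono (k : Fin K) : Monotone fun n => pulls (history Γ l x n) k :=
  monotone_nat_of_le_succ fun n => by simp [pulls_history_succ]

theorem pulls_history_lt {k : Fin K} {r s : ℕ} (hrs : r < s) (hr : action Γ l x r = k) :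
    pulls (history Γ l x r) k < pulls (history Γ l x s) k := by
  have h := pulls_history_mono Γ l x k (Nat.succ_le_of_lt hrs)
  simp only [Nat.succ_eq_add_one, pulls_history_succ, hr, if_true] at h
  omega

theorem pulls_le {n : ℕ} (h : Fin n → Obs K) (k : Fin K) : pulls h k ≤ n := by
  simpa [pulls] using Finset.card_filter_le (Finset.univ : Finset (Fin n)) fun s => (h s).2.1 = k

/-- The pull counter increases strictly along the pulls of `k`, so it maps these slots injectively
into `range m`. -/
theorem card_pulls_lt_le (k : Fin K) (T m : ℕ) :
    ((Finset.range T).filter fun n =>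
      action Γ l x n = k ∧ pulls (history Γ l x n) k < m).card ≤ m := by
  have := Finset.card_le_card_of_injOn (s := (Finset.range T).filter fun n =>
      action Γ l x n = k ∧ pulls (history Γ l x n) k < m) (t := Finset.range m)
      (fun n => pulls (history Γ l x n) k)
      (by
        intro n hn
        simp only [Finset.coe_filter, Set.mem_ofPred_eq] at hn
        simpa using hn.2.2)
      (by
        intro r hr s hs hrs
        simp only [Finset.coe_filter, Set.mem_ofPred_eq] at hr hs
        rcases lt_trichotomy r s with h | h | h
        · exact absurd hrs (pulls_history_lt Γ l x h hr.2.1).ne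
        · exact h
        · exact absurd hrs (pulls_history_lt Γ l x h hs.2.1).ne')
  simpa using this

theorem empMean_eq {n : ℕ} {h : Fin n → Obs K} {k : Fin K} (hk : pulls h k ≠ 0) :
    empMean h k = rewardSum h k / pulls h k := by
  simp [empMean, rewardSum, hk]

/-- The initial slots never repeat an arm, and an injective self-map of `Fin K` is onto. This keeps
the division by zero in the index out of play. -/
theorem IsAdaUCB.pulls_pos {α lo hi : ℝ} {Γ : Policy K} (hΓ : IsAdaUCB α lo hi Γ)
    {n : ℕ} (hn : K ≤ n) (k : Fin K) : 0 < pulls (history Γ l x n) k := by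
  have hinj : Function.Injective fun i : Fin K => action Γ l x i := by
    have key : ∀ i j : Fin K, i < j → action Γ l x i ≠ action Γ l x j := by
      intro i j hij h
      have h0 : pulls (history Γ l x j) (action Γ l x j) = 0 := hΓ.init j j.2 _ _
      have := pulls_history_lt Γ l x hij h
      omega
    intro i j hij
    rcases lt_trichotomy i j with h | h | h
    · exact absurd hij (key i j h)
    · exact h
    · exact absurd hij.symm (key j i h)
  obtain ⟨i, hi⟩ := (Finite.injective_iff_surjective.mp hinj) k
  exact (Nat.zero_le _).trans_lt (pulls_history_lt Γ l x (i.2.trans_le hn) hi)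

/-- A large set of slots contains a slot at which the pulled arm has already been pulled often. -/
theorem exists_pulls_ge_of_card {A : Finset ℕ} {c : ℝ} (hc : 0 < c) (hA : K * c ≤ (A.card : ℝ))
    (hK : 0 < K) : ∃ s ∈ A, c - 1 ≤ (pulls (history Γ l x s) (action Γ l x s) : ℝ) := by
  have hne : (Finset.univ : Finset (Fin K)).Nonempty := ⟨⟨0, hK⟩, Finset.mem_univ _⟩
  obtain ⟨j, -, hj⟩ := Finset.exists_le_card_fiber_of_nsmul_le_card_of_maps_to
    (s := A) (t := (Finset.univ : Finset (Fin K))) (f := fun s => action Γ l x s) (b := c)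
    (fun _ _ => Finset.mem_univ _) hne (by simpa using hA)
  set B := A.filter fun s => action Γ l x s = j with hB
  have hBne : B.Nonempty := by
    rw [← Finset.card_pos]
    exact_mod_cast hc.trans_le hj
  have hmem := Finset.max'_mem B hBne
  set s := B.max' hBne with hs
  have hmem' := Finset.mem_filter.mp hmem
  refine ⟨s, hmem'.1, ?_⟩
  rw [hmem'.2]
  -- `s` is the last slot of the largest fiber, so all its other slots precede `s`; excluding `s`
  -- itself costs the 1 in `c - 1`.
  have hsub : B.erase s ⊆ (Finset.range s).filter fun r => action Γ l x r = j := by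
    intro r hr
    rw [Finset.mem_erase] at hr
    rw [Finset.mem_filter, Finset.mem_range]
    exact ⟨lt_of_le_of_ne (B.le_max' r hr.2) hr.1, (Finset.mem_filter.mp hr.2).2⟩
  have hcard := Finset.card_le_card hsub
  rw [Finset.card_erase_of_mem hmem, Finset.card_filter _ (Finset.range s),
    ← pulls_history_eq_sum] at hcard
  have : (B.card : ℝ) ≤ pulls (history Γ l x s) j + 1 := by
    exact_mod_cast Nat.sub_le_iff_le_add.mp hcard
  linarith

theorem normLoad_self {lo : ℝ} (h : lo ≤ 1) : normLoad lo 1 lo = 0 := by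
  simp [normLoad, h]

theorem one_sub_normLoad_high {ε₀ ε₁ : ℝ} (h₀ : ε₀ < 1 / 2) (h₁ : ε₁ ∈ Set.Ico (0 : ℝ) (1 / 2)) :
    1 - normLoad ε₀ 1 (1 - ε₁) = ε₁ / (1 - ε₀) := by
  have h2 : 1 - ε₀ ≠ 0 := by linarith
  rw [normLoad, min_eq_left (by linarith [h₁.1]), max_eq_right (by linarith [h₁.2])]
  field_simp
  ring

/-- The full exploration bonus of an arm. -/
noncomputable def bonus (α : ℝ) {n : ℕ} (h : Fin n → Obs K) (k : Fin K) : ℝ :=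
  √(α * Real.log ((n : ℝ) + 1) / (pulls h k : ℝ))

theorem bonus_nonneg (α : ℝ) {n : ℕ} (h : Fin n → Obs K) (k : Fin K) : 0 ≤ bonus α h k :=
  Real.sqrt_nonneg _

theorem index_low {α ε₀ : ℝ} (h₀ : ε₀ < 1 / 2) {n : ℕ} (h : Fin n → Obs K) (k : Fin K) :
    index α ε₀ 1 ε₀ h k = empMean h k + bonus α h k := by
  simp [index, bonus, normLoad_self (show ε₀ ≤ 1 by linarith)]

theorem index_high {α ε₀ ε₁ : ℝ} (h₀ : ε₀ < 1 / 2) (h₁ : ε₁ ∈ Set.Ico (0 : ℝ) (1 / 2)) {n : ℕ}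
    (h : Fin n → Obs K) (k : Fin K) :
    index α ε₀ 1 (1 - ε₁) h k = empMean h k + √(ε₁ / (1 - ε₀)) * bonus α h k := by
  have h2 : 0 ≤ ε₁ / (1 - ε₀) := div_nonneg h₁.1 (by linarith)
  rw [index, one_sub_normLoad_high h₀ h₁, bonus, ← Real.sqrt_mul h2]
  congr 2
  ring

/-- Off the atypical event, a late slot in which a suboptimal arm is pulled has low load, and
the arm has not been pulled often before. -/
theorem IsAdaUCB.low_and_pulls_lt {α ε₀ ε₁ ρ : ℝ} {Γ : Policy K} (hΓ : IsAdaUCB α ε₀ 1 Γ)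
    (hα : 0 < α) (h₀ : ε₀ < 1 / 2) (h₁ : ε₁ ∈ Set.Ico (0 : ℝ) (1 / 2))
    (hε : √(ε₁ / (1 - ε₀)) < 1 / 8) {u : Fin K → ℝ} {kstar : Fin K} (hu : ∀ j, u j ≤ u kstar)
    {n : ℕ} (hload : l n = ε₀ ∨ l n = 1 - ε₁)
    (hconc : ∀ j, ∀ s ≤ n, pulls (history Γ l x s) j ≠ 0 →
      |empMean (history Γ l x s) j - u j| ≤
        1 / 4 * √(α * Real.log (((n : ℝ) + 1) / 2) / pulls (history Γ l x s) j))
    (hcount : ρ * n / 4 ≤ (((Finset.Ico (n / 2) n).filter fun s => l s = ε₀).card : ℝ))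
    (hnK : 2 * K ≤ n) (hn3 : 3 ≤ n) (hpos : 0 < ρ * n / (4 * K) - 1)
    {k : Fin K} (hk : u k < u kstar)
    (hlate : α * Real.log ((n : ℝ) + 1) ≤ ((u kstar - u k) / 8) ^ 2 * (ρ * n / (4 * K) - 1))
    (hact : action Γ l x n = k) :
    l n = ε₀ ∧
      (pulls (history Γ l x n) k : ℝ) < 4 * α * Real.log ((n : ℝ) + 1) / (u kstar - u k) ^ 2 := by
  have hK : 0 < K := Fin.pos k
  set D := u kstar - u k with hD
  have hDpos : 0 < D := by linarith
  have hn3' : (3 : ℝ) ≤ n := by exact_mod_cast hn3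
  have hlogpos : 0 < Real.log ((n : ℝ) + 1) := Real.log_pos (by linarith)
  -- The logarithm of (n+1)/2 serves the whole window at once, since s + 1 ≥ (n+1)/2 for s ≥ n/2.
  have hconc' : ∀ j, ∀ s, n / 2 ≤ s → s ≤ n →
      |empMean (history Γ l x s) j - u j| ≤ 1 / 4 * bonus α (history Γ l x s) j := by
    intro j s hs1 hs2
    refine (hconc j s hs2 (hΓ.pulls_pos l x (by omega) j).ne').trans ?_
    unfold bonus
    have : ((n : ℝ) + 1) / 2 ≤ (s : ℝ) + 1 := by
      have : n ≤ 2 * s + 1 := by omega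
      have : (n : ℝ) ≤ 2 * s + 1 := by exact_mod_cast this
      linarith
    gcongr
  have hnn : n / 2 ≤ n := Nat.div_le_self _ _
  have hmax : ∀ s, K ≤ s → ∀ j, index α ε₀ 1 (l s) (history Γ l x s) j ≤
      index α ε₀ 1 (l s) (history Γ l x s) (action Γ l x s) :=
    fun s hs j => hΓ.argmax s hs _ _ j
  have hNk : (0 : ℝ) < pulls (history Γ l x n) k := by
    exact_mod_cast hΓ.pulls_pos l x (by omega) k
  have hmaxn := hmax n (by omega) kstar
  rw [hact] at hmaxn
  have c1 := abs_le.mp (hconc' kstar n hnn le_rfl)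
  have ck := abs_le.mp (hconc' k n hnn le_rfl)
  have b1 := bonus_nonneg α (history Γ l x n) kstar
  have bk := bonus_nonneg α (history Γ l x n) k
  have hlow : l n = ε₀ := by
    refine hload.resolve_right fun hhigh => ?_
    rw [hhigh, index_high h₀ h₁, index_high h₀ h₁] at hmaxn
    -- a low-load slot of the window at which some frequently pulled arm was chosen
    obtain ⟨s, hsA, hs⟩ := exists_pulls_ge_of_card Γ l x
      (A := (Finset.Ico (n / 2) n).filter fun s => l s = ε₀) (c := ρ * n / (4 * K))
      (by linarith) (by
        refine le_trans (le_of_eq ?_) hcount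
        have : (K : ℝ) ≠ 0 := by exact_mod_cast hK.ne'
        field_simp) hK
    rw [Finset.mem_filter, Finset.mem_Ico] at hsA
    obtain ⟨⟨hs1, hs2⟩, hsl⟩ := hsA
    set j := action Γ l x s with hj
    have hsn : (s : ℝ) + 1 ≤ n + 1 := by
      have : (s : ℝ) ≤ n := by exact_mod_cast hs2.le
      linarith
    have hbj : bonus α (history Γ l x s) j ≤ D / 8 := by
      unfold bonus
      rw [show D / 8 = √((D / 8) ^ 2) from (Real.sqrt_sq (by positivity)).symm]
      apply Real.sqrt_le_sqrt
      rw [div_le_iff₀ (hpos.trans_le hs)]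
      calc α * Real.log ((s : ℝ) + 1) ≤ α * Real.log ((n : ℝ) + 1) := by gcongr
        _ ≤ _ := hlate
        _ ≤ _ := by gcongr
    -- Arm `j` beat arm `i` at slot `s` with full bonuses; the quarter-bonus errors turn 1 into 3/4
    -- for `i` and into 5/4 for `j`.
    have cmp : ∀ i, 3 / 4 * bonus α (history Γ l x s) i ≤ u kstar - u i + 5 / 4 * (D / 8) := by
      intro i
      have h := hmax s (by omega) i
      rw [hsl, index_low h₀, index_low h₀, ← hj] at h
      have ci := abs_le.mp (hconc' i s hs1 hs2.le)
      have cj := abs_le.mp (hconc' j s hs1 hs2.le)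
      linarith [hu j]
    -- the bonuses do not grow much between the two slots
    have grow : ∀ i, bonus α (history Γ l x n) i ≤ 3 / 2 * bonus α (history Γ l x s) i := by
      intro i
      unfold bonus
      rw [show (3 / 2 : ℝ) = √((3 / 2) ^ 2) from (Real.sqrt_sq (by norm_num)).symm,
        ← Real.sqrt_mul (by norm_num)]
      apply Real.sqrt_le_sqrt
      have hp : (0 : ℝ) < pulls (history Γ l x s) i := by
        exact_mod_cast hΓ.pulls_pos l x (by omega) i
      have hpm : (pulls (history Γ l x s) i : ℝ) ≤ pulls (history Γ l x n) i := by
        exact_mod_cast pulls_history_mono Γ l x i hs2.le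
      -- From n + 1 ≤ 2(s + 1) ≤ (s + 1)². The bonuses grow by at most √2 ≤ 3/2.
      have hlog : Real.log ((n : ℝ) + 1) ≤ 2 * Real.log ((s : ℝ) + 1) := by
        have h1 : n + 1 ≤ (s + 1) * (s + 1) := by
          have : n + 1 ≤ 2 * (s + 1) := by omega
          have : 2 ≤ s + 1 := by omega
          nlinarith
        have h2 : (n : ℝ) + 1 ≤ ((s : ℝ) + 1) ^ 2 := by
          rw [sq]; exact_mod_cast h1
        calc Real.log ((n : ℝ) + 1) ≤ Real.log (((s : ℝ) + 1) ^ 2) :=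
              Real.log_le_log (by positivity) h2
          _ = _ := by rw [Real.log_pow]; norm_num
      have hls : 0 ≤ Real.log ((s : ℝ) + 1) := Real.log_nonneg (by
        have : (0 : ℝ) ≤ s := by positivity
        linarith)
      calc α * Real.log ((n : ℝ) + 1) / pulls (history Γ l x n) i
          ≤ α * Real.log ((n : ℝ) + 1) / pulls (history Γ l x s) i := by gcongr
        _ ≤ α * ((3 / 2) ^ 2 * Real.log ((s : ℝ) + 1)) / pulls (history Γ l x s) i := by
            gcongr; linarith
        _ = _ := by ring
    have hk' : √(ε₁ / (1 - ε₀)) * bonus α (history Γ l x n) k ≤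
        1 / 8 * bonus α (history Γ l x n) k := by gcongr
    have h1' : 0 ≤ √(ε₁ / (1 - ε₀)) * bonus α (history Γ l x n) kstar := by positivity
    -- At slot `n` the bonuses of `k` and `kstar` are at most 37D/16 and 5D/16. So the index of `k`
    -- is at most u k + (3/8)(37D/16) and that of `kstar` at least u kstar - (1/4)(5D/16); as
    -- 111/128 + 10/128 < 1, `k` cannot win.
    linarith [cmp k, cmp kstar, grow k, grow kstar]
  refine ⟨hlow, ?_⟩
  by_contra! hN
  rw [hlow, index_low h₀, index_low h₀] at hmaxn
  -- The constant 4 in the pull threshold is what gives D/2; then the index of `k` exceeds u k by at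
  -- most (5/4)(D/2) < D.
  have hbk : bonus α (history Γ l x n) k ≤ D / 2 := by
    unfold bonus
    rw [show D / 2 = √((D / 2) ^ 2) from (Real.sqrt_sq (by positivity)).symm]
    apply Real.sqrt_le_sqrt
    rw [div_le_iff₀ hNk]
    rw [div_le_iff₀ (by positivity)] at hN
    linarith
  linarith

end Path

/-! ### Exponential supermartingale with predictable selection. -/

section Martingale

variable {Ω : Type*} [mΩ : MeasurableSpace Ω] {μ : Measure Ω}

open scoped Classical in
/-- A product of predictably selected factors, each independent of the past and of mean at
most one, has mean at most one. -/
theorem lintegral_prod_selected_le_one [IsProbabilityMeasure μ] {F : ℕ → MeasurableSpace Ω}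
    (hF : Monotone F) (hFle : ∀ n, F n ≤ mΩ) {A : ℕ → Set Ω} (hA : ∀ n, MeasurableSet[F n] (A n))
    {f : ℕ → Ω → ENNReal} {G : ℕ → MeasurableSpace Ω} (hGF : ∀ n, G n ≤ F (n + 1))
    (hf : ∀ n, Measurable[G n] (f n)) (hind : ∀ n, Indep (F n) (G n) μ)
    (hint : ∀ n, ∫⁻ ω, f n ω ∂μ ≤ 1) (n : ℕ) :
    (Measurable[F n] fun ω => ∏ s ∈ Finset.range n, if ω ∈ A s then f s ω else 1) ∧
      ∫⁻ ω, ∏ s ∈ Finset.range n, (if ω ∈ A s then f s ω else 1) ∂μ ≤ 1 := by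
  induction n with
  | zero => simp
  | succ n ih =>
    obtain ⟨hm, hi⟩ := ih
    set P : Ω → ENNReal := fun ω => ∏ s ∈ Finset.range n, if ω ∈ A s then f s ω else 1 with hP
    have hstep : Measurable[F (n + 1)] fun ω => if ω ∈ A n then f n ω else 1 :=
      Measurable.ite (hF n.le_succ _ (hA n)) ((hf n).mono (hGF n) le_rfl) measurable_const
    have hP1 : Measurable[F (n + 1)] P := hm.mono (hF n.le_succ) le_rfl
    simp_rw [Finset.prod_range_succ]
    refine ⟨hP1.mul hstep, ?_⟩
    have hm1 : Measurable[F n] ((A n).indicator P) := hm.indicator (hA n)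
    have hm1' : Measurable ((A n).indicator P) := hm1.mono (hFle n) le_rfl
    have hfm : Measurable (f n) := (hf n).mono ((hGF n).trans (hFle _)) le_rfl
    -- Only on `A n` does the new factor enter, and there P restricted to `A n` is `F n`-measurable,
    -- hence independent of it.
    have hsplit : ∀ ω, P ω * (if ω ∈ A n then f n ω else 1) =
        (A n).indicator P ω * f n ω + (A n)ᶜ.indicator P ω := by
      intro ω
      by_cases h : ω ∈ A n <;> simp [h]
    calc ∫⁻ ω, P ω * (if ω ∈ A n then f n ω else 1) ∂μ
        = ∫⁻ ω, (A n).indicator P ω * f n ω ∂μ + ∫⁻ ω, (A n)ᶜ.indicator P ω ∂μ := by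
          simp_rw [hsplit]
          exact lintegral_add_left (hm1'.mul hfm) _
      _ = (∫⁻ ω, (A n).indicator P ω ∂μ) * (∫⁻ ω, f n ω ∂μ) +
            ∫⁻ ω, (A n)ᶜ.indicator P ω ∂μ := by
          rw [lintegral_mul_eq_lintegral_mul_lintegral_of_independent_measurableSpace (hFle n)
            ((hGF n).trans (hFle _)) (hind n) hm1 (hf n)]
      _ ≤ (∫⁻ ω, (A n).indicator P ω ∂μ) * 1 + ∫⁻ ω, (A n)ᶜ.indicator P ω ∂μ := by
          gcongr; exact hint n
      _ = ∫⁻ ω, P ω ∂μ := by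
          rw [mul_one, lintegral_indicator (hFle n _ (hA n)),
            lintegral_indicator (hFle n _ (hA n)).compl, lintegral_add_compl _ (hFle n _ (hA n))]
      _ ≤ 1 := hi

/-- Hoeffding's lemma, in the form used for the exponential supermartingale. -/
theorem lintegral_exp_centered_le_one [IsProbabilityMeasure μ] {Y : Ω → ℝ} (hY : Measurable Y)
    (h01 : ∀ᵐ ω ∂μ, Y ω ∈ Set.Icc (0 : ℝ) 1) {m : ℝ} (hm : ∫ ω, Y ω ∂μ = m) (t : ℝ) :
    ∫⁻ ω, ENNReal.ofReal (Real.exp (t * (Y ω - m) - t ^ 2 / 8)) ∂μ ≤ 1 := by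
  have hs := hasSubgaussianMGF_of_mem_Icc hY.aemeasurable h01
  rw [hm] at hs
  have hle := hs.mgf_le t
  have hint := hs.integrable_exp_mul t
  have heq : ∀ ω, Real.exp (t * (Y ω - m) - t ^ 2 / 8) =
      Real.exp (t * (Y ω - m)) * Real.exp (-(t ^ 2 / 8)) := by
    intro ω; rw [← Real.exp_add]; ring_nf
  rw [← ofReal_integral_eq_lintegral_ofReal]
  · rw [ENNReal.ofReal_le_one]
    simp_rw [heq]
    rw [integral_mul_const, Real.exp_neg, ← div_eq_mul_inv, div_le_one (Real.exp_pos _)]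
    refine hle.trans (Real.exp_le_exp.mpr (le_of_eq ?_))
    simp
    ring
  · simp_rw [heq]
    exact hint.mul_const _
  · exact Filter.Eventually.of_forall fun ω => (Real.exp_pos _).le

end Martingale

/-! ### Filtration, independence and concentration. -/

section Play

variable {K : ℕ} {Ω : Type*}

/-- The indices of the variables that are known when the arm of slot `n` is chosen. -/
def pastIndex (K : ℕ) (n : ℕ) : Set (ℕ ⊕ (Fin K × ℕ)) :=
  {i | Sum.elim (fun m => m ≤ n) (fun p => p.2 < n) i}

/-- The information available when the arm of slot `n` is chosen. -/
@[reducible]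
def past (L : ℕ → Ω → ℝ) (X : Fin K → ℕ → Ω → ℝ) (n : ℕ) : MeasurableSpace Ω :=
  ⨆ i ∈ pastIndex K n,
    MeasurableSpace.comap (Sum.elim L (fun p : Fin K × ℕ => X p.1 p.2) i) inferInstance

theorem past_mono (L : ℕ → Ω → ℝ) (X : Fin K → ℕ → Ω → ℝ) : Monotone (past L X) := by
  intro m n hmn
  refine biSup_mono fun i hi => ?_
  rcases i with i | p
  · exact le_trans (show i ≤ m from hi) hmn
  · exact lt_of_lt_of_le (show p.2 < m from hi) hmn

theorem comap_le_past {L : ℕ → Ω → ℝ} {X : Fin K → ℕ → Ω → ℝ} {n : ℕ} {i : ℕ ⊕ (Fin K × ℕ)}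
    (hi : i ∈ pastIndex K n) :
    MeasurableSpace.comap (Sum.elim L (fun p : Fin K × ℕ => X p.1 p.2) i) inferInstance ≤
      past L X n :=
  le_biSup (fun i => MeasurableSpace.comap (Sum.elim L (fun p : Fin K × ℕ => X p.1 p.2) i)
    inferInstance) hi

theorem measurable_load_past {L : ℕ → Ω → ℝ} {X : Fin K → ℕ → Ω → ℝ} {m n : ℕ} (h : m ≤ n) :
    Measurable[past L X n] (L m) :=
  measurable_iff_comap_le.mpr (comap_le_past (L := L) (X := X) (i := Sum.inl m) h)

theorem measurable_reward_past {L : ℕ → Ω → ℝ} {X : Fin K → ℕ → Ω → ℝ} {m n : ℕ} (h : m < n)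
    (k : Fin K) : Measurable[past L X n] (X k m) :=
  measurable_iff_comap_le.mpr (comap_le_past (L := L) (X := X) (i := Sum.inr (k, m)) h)

/-- The σ-algebra is left arbitrary so that the lemma applies to `past`, giving adaptedness. -/
theorem measurable_history_of {_ : MeasurableSpace Ω} {L : ℕ → Ω → ℝ} {X : Fin K → ℕ → Ω → ℝ}
    {Γ : Policy K} (hΓ : ∀ n, Measurable fun p : ℝ × (Fin n → Obs K) => Γ n p.1 p.2) (n : ℕ)
    (hL : ∀ m < n, Measurable (L m)) (hX : ∀ k, ∀ m < n, Measurable (X k m)) :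
    Measurable fun ω => history Γ (fun m => L m ω) (fun k m => X k m ω) n := by
  induction n with
  | zero => exact measurable_pi_iff.mpr fun i => i.elim0
  | succ n ih =>
    have hh := ih (fun m hm => hL m (by omega)) fun k m hm => hX k m (by omega)
    have hLn := hL n (by omega)
    have ha : Measurable fun ω => action Γ (fun m => L m ω) (fun k m => X k m ω) n :=
      (hΓ n).comp (hLn.prodMk hh)
    have hx : Measurable fun ω => X (action Γ (fun m => L m ω) (fun k m => X k m ω) n) n ω :=
      (measurable_from_prod_countable_right (f := fun p : Fin K × Ω => X p.1 n p.2)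
        fun k => hX k n (by omega)).comp (ha.prodMk measurable_id)
    refine measurable_pi_iff.mpr fun i => ?_
    simp_rw [history_succ]
    refine Fin.lastCases ?_ (fun j => ?_) i
    · simp only [Fin.snoc_last]
      exact hLn.prodMk (ha.prodMk hx)
    · simp only [Fin.snoc_castSucc]
      exact (measurable_pi_apply j).comp hh

theorem measurable_history_past {L : ℕ → Ω → ℝ} {X : Fin K → ℕ → Ω → ℝ}
    {Γ : Policy K} (hΓ : ∀ n, Measurable fun p : ℝ × (Fin n → Obs K) => Γ n p.1 p.2) (n : ℕ) :
    Measurable[past L X n] fun ω => history Γ (fun m => L m ω) (fun k m => X k m ω) n :=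
  @measurable_history_of K Ω (past L X n) L X Γ hΓ n (fun _ hm => measurable_load_past hm.le)
    fun k _ hm => measurable_reward_past hm k

theorem measurable_action_past {L : ℕ → Ω → ℝ} {X : Fin K → ℕ → Ω → ℝ}
    {Γ : Policy K} (hΓ : ∀ n, Measurable fun p : ℝ × (Fin n → Obs K) => Γ n p.1 p.2) (n : ℕ) :
    Measurable[past L X n] fun ω => action Γ (fun m => L m ω) (fun k m => X k m ω) n :=
  (hΓ n).comp (Measurable.prodMk (measurable_load_past le_rfl) (measurable_history_past hΓ n))

theorem measurable_pulls {n : ℕ} (k : Fin K) : Measurable fun h : Fin n → Obs K => pulls h k := by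
  simp_rw [pulls_eq_sum]
  refine Finset.measurable_sum _ fun s _ => ?_
  refine Measurable.ite ?_ measurable_const measurable_const
  exact ((measurable_fst.comp measurable_snd).comp (measurable_pi_apply s))
    (measurableSet_singleton k)

variable [mΩ : MeasurableSpace Ω] {μ : Measure Ω} {L : ℕ → Ω → ℝ} {X : Fin K → ℕ → Ω → ℝ}
  {ε₀ ε₁ ρ : ℝ} {u : Fin K → ℝ}

theorem BinaryLoadBandit.comap_le (hB : BinaryLoadBandit μ L X ε₀ ε₁ ρ u)
    (i : ℕ ⊕ (Fin K × ℕ)) :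
    MeasurableSpace.comap (Sum.elim L (fun p : Fin K × ℕ => X p.1 p.2) i) inferInstance ≤ mΩ := by
  rcases i with m | p
  · exact (hB.measurable_load m).comap_le
  · exact (hB.measurable_reward p.1 p.2).comap_le

theorem BinaryLoadBandit.past_le (hB : BinaryLoadBandit μ L X ε₀ ε₁ ρ u) (n : ℕ) :
    past L X n ≤ mΩ :=
  iSup₂_le fun i _ => hB.comap_le i

/-- The past contains the current load but no current reward, so the two blocks of the independent
family are disjoint. -/
theorem BinaryLoadBandit.indep_past (hB : BinaryLoadBandit μ L X ε₀ ε₁ ρ u) (k : Fin K) (n : ℕ) :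
    Indep (past L X n) (MeasurableSpace.comap (X k n) inferInstance) μ := by
  have h := indep_iSup_of_disjoint (fun i => hB.comap_le i) hB.indep
    (S := pastIndex K n) (T := {Sum.inr (k, n)}) (by
      rw [Set.disjoint_singleton_right]
      exact fun h => lt_irrefl n h)
  simpa [past] using h

/-- Selecting the first `m` pulls of an arm. -/
theorem sum_first_pulls (Γ : Policy K) (l : ℕ → ℝ) (x : Fin K → ℕ → ℝ) (k : Fin K) {s T m : ℕ}
    (hsT : s ≤ T) (hm : pulls (history Γ l x s) k = m) (g : ℕ → ℝ) :
    (∑ r ∈ Finset.range T,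
        if action Γ l x r = k ∧ pulls (history Γ l x r) k < m then g r else 0) =
      ∑ r ∈ Finset.range s, if action Γ l x r = k then g r else 0 := by
  rw [← Finset.sum_subset (Finset.range_mono hsT)]
  · refine Finset.sum_congr rfl fun r hr => ?_
    by_cases h : action Γ l x r = k
    · have := pulls_history_lt Γ l x (Finset.mem_range.mp hr) h
      simp [h, ← hm, this]
    · simp [h]
  · intro r _ hr
    have hmono := pulls_history_mono Γ l x k (show s ≤ r by simpa using hr)
    simp only at hmono
    rw [if_neg]
    rintro ⟨-, h⟩
    omega

/-- One-sided deviation bound for the average of the first `m` pulls of an arm; `σ = 1` and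
`σ = -1` give the two sides. -/
theorem BinaryLoadBandit.measure_deviation_of_pulls_eq [IsProbabilityMeasure μ]
    (hB : BinaryLoadBandit μ L X ε₀ ε₁ ρ u) {Γ : Policy K}
    (hΓ : ∀ n, Measurable fun p : ℝ × (Fin n → Obs K) => Γ n p.1 p.2) (k : Fin K) (T m : ℕ)
    {ε σ : ℝ} (hε : 0 ≤ ε) (hσ : σ ^ 2 = 1) :
    μ {ω | ∃ s ≤ T, pulls (history Γ (fun m => L m ω) (fun k m => X k m ω) s) k = m ∧
        m * ε ≤ σ * (rewardSum (history Γ (fun m => L m ω) (fun k m => X k m ω) s) k - m * u k)} ≤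
      ENNReal.ofReal (Real.exp (-(2 * m * ε ^ 2))) := by
  classical
  let A : ℕ → Set Ω := fun r => {ω |
    action Γ (fun m => L m ω) (fun k m => X k m ω) r = k ∧
      pulls (history Γ (fun m => L m ω) (fun k m => X k m ω) r) k < m}
  -- The tilt 4ε maximizes tε - t²/8, with value 2ε².
  let e : ℕ → Ω → ℝ := fun r ω => 4 * ε * σ * (X k r ω - u k) - (4 * ε * σ) ^ 2 / 8
  let f : ℕ → Ω → ENNReal := fun r ω => ENNReal.ofReal (Real.exp (e r ω))
  have hA : ∀ r, MeasurableSet[past L X r] (A r) := by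
    intro r
    refine MeasurableSet.inter ?_ ?_
    · exact measurable_action_past hΓ r (measurableSet_singleton k)
    · exact ((measurable_pulls k).comp (measurable_history_past hΓ r)) (measurableSet_Iio (a := m))
  have hf : ∀ r, Measurable[MeasurableSpace.comap (X k r) inferInstance] (f r) := by
    intro r
    have : Measurable fun y : ℝ =>
        ENNReal.ofReal (Real.exp (4 * ε * σ * (y - u k) - (4 * ε * σ) ^ 2 / 8)) := by fun_prop
    exact this.comp (comap_measurable (X k r))
  obtain ⟨hmeas, hle⟩ := lintegral_prod_selected_le_one (μ := μ) (past_mono L X) hB.past_le hA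
    (G := fun r => MeasurableSpace.comap (X k r) inferInstance)
    (fun r => comap_le_past (L := L) (X := X) (i := Sum.inr (k, r)) (Nat.lt_succ_self r)) hf
    (fun r => hB.indep_past k r)
    (fun r => lintegral_exp_centered_le_one (hB.measurable_reward k r) (hB.reward_mem k r)
      (hB.reward_mean k r) (4 * ε * σ)) T
  have hprod : ∀ ω, (∏ s ∈ Finset.range T, if ω ∈ A s then f s ω else 1) =
      ENNReal.ofReal (Real.exp (∑ s ∈ Finset.range T, if ω ∈ A s then e s ω else 0)) := by
    intro ω
    rw [Real.exp_sum, ENNReal.ofReal_prod_of_nonneg fun _ _ => (Real.exp_pos _).le]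
    refine Finset.prod_congr rfl fun s _ => ?_
    split_ifs <;> simp [f]
  have hpos : 0 < Real.exp (2 * m * ε ^ 2) := Real.exp_pos _
  have hmarkov := meas_ge_le_lintegral_div (hmeas.mono (hB.past_le T) le_rfl).aemeasurable (μ := μ)
    (ε := ENNReal.ofReal (Real.exp (2 * m * ε ^ 2))) (by simpa using hpos) ENNReal.ofReal_ne_top
  refine (measure_mono ?_).trans (hmarkov.trans ?_)
  · rintro ω ⟨s, hsT, hm, hdev⟩
    rw [Set.mem_ofPred_eq]
    refine le_of_le_of_eq ?_ ((hprod ω).symm.trans (by congr!))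
    refine ENNReal.ofReal_le_ofReal (Real.exp_le_exp.mpr ?_)
    have hsum := sum_first_pulls Γ (fun m => L m ω) (fun k m => X k m ω) k hsT hm (fun r => e r ω)
    have hsel : (∑ r ∈ Finset.range s,
        if action Γ (fun m => L m ω) (fun k m => X k m ω) r = k then e r ω else 0) =
        4 * ε * σ * (rewardSum (history Γ (fun m => L m ω) (fun k m => X k m ω) s) k - m * u k) -
          m * ((4 * ε * σ) ^ 2 / 8) := by
      have hm' : (m : ℝ) = ∑ r ∈ Finset.range s,
          if action Γ (fun m => L m ω) (fun k m => X k m ω) r = k then (1 : ℝ) else 0 := by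
        rw [← hm, pulls_history_eq_sum]
        push_cast
        rfl
      rw [rewardSum_history_eq_sum, hm', Finset.sum_mul, Finset.sum_mul, ← Finset.sum_sub_distrib,
        Finset.mul_sum, ← Finset.sum_sub_distrib]
      refine Finset.sum_congr rfl fun r _ => ?_
      split_ifs <;> simp [e]
    have hA' : (∑ r ∈ Finset.range T, if ω ∈ A r then e r ω else 0) = _ := hsum
    rw [hA', hsel]
    have := mul_le_mul_of_nonneg_left hdev (show 0 ≤ 4 * ε by linarith)
    rw [show (4 * ε * σ) ^ 2 = 16 * ε ^ 2 * σ ^ 2 by ring, hσ]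
    linarith
  · calc _ ≤ 1 / ENNReal.ofReal (Real.exp (2 * m * ε ^ 2)) := by gcongr
      _ = _ := by rw [one_div, ← ENNReal.ofReal_inv_of_pos hpos, Real.exp_neg]

/-- Uniform deviation bound for the empirical mean of an arm. -/
theorem BinaryLoadBandit.measure_deviation_le [IsProbabilityMeasure μ]
    (hB : BinaryLoadBandit μ L X ε₀ ε₁ ρ u) {Γ : Policy K}
    (hΓ : ∀ n, Measurable fun p : ℝ × (Fin n → Obs K) => Γ n p.1 p.2) (k : Fin K) (T : ℕ)
    {v : ℝ} (hv : 0 ≤ v) :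
    μ {ω | ∃ s ≤ T, pulls (history Γ (fun m => L m ω) (fun k m => X k m ω) s) k ≠ 0 ∧
        √(v / pulls (history Γ (fun m => L m ω) (fun k m => X k m ω) s) k) <
          |empMean (history Γ (fun m => L m ω) (fun k m => X k m ω) s) k - u k|} ≤
      ENNReal.ofReal (2 * T * Real.exp (-(2 * v))) := by
  -- With deviation √(v/m) the exponent 2mε² equals 2v for every `m`, so the union over `m` costs
  -- only a factor `T`.
  let E : ℝ → ℕ → Set Ω := fun σ m =>
    {ω | ∃ s ≤ T, pulls (history Γ (fun m => L m ω) (fun k m => X k m ω) s) k = m ∧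
        m * √(v / m) ≤
          σ * (rewardSum (history Γ (fun m => L m ω) (fun k m => X k m ω) s) k - m * u k)}
  have hE : ∀ σ, σ ^ 2 = 1 → ∀ m ∈ Finset.Icc 1 T,
      μ (E σ m) ≤ ENNReal.ofReal (Real.exp (-(2 * v))) := by
    intro σ hσ m hm
    refine (hB.measure_deviation_of_pulls_eq hΓ k T m (Real.sqrt_nonneg _) hσ).trans
      (le_of_eq ?_)
    have hm0 : (m : ℝ) ≠ 0 := by
      have := (Finset.mem_Icc.mp hm).1
      exact_mod_cast (by omega : m ≠ 0)
    rw [Real.sq_sqrt (by positivity)]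
    congr 3
    field_simp
  have hsub : {ω | ∃ s ≤ T, pulls (history Γ (fun m => L m ω) (fun k m => X k m ω) s) k ≠ 0 ∧
        √(v / pulls (history Γ (fun m => L m ω) (fun k m => X k m ω) s) k) <
          |empMean (history Γ (fun m => L m ω) (fun k m => X k m ω) s) k - u k|} ⊆
      ⋃ m ∈ Finset.Icc 1 T, (E 1 m ∪ E (-1) m) := by
    rintro ω ⟨s, hsT, hne, hdev⟩
    set m := pulls (history Γ (fun m => L m ω) (fun k m => X k m ω) s) k with hm
    have hm0 : (0 : ℝ) < m := by exact_mod_cast Nat.pos_of_ne_zero hne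
    rw [empMean_eq hne, ← hm] at hdev
    simp only [Set.mem_iUnion]
    refine ⟨m, Finset.mem_Icc.mpr ⟨Nat.pos_of_ne_zero hne, (pulls_le _ k).trans hsT⟩, ?_⟩
    have key : ∀ S : ℝ, m * (S / m - u k) = S - m * u k := by
      intro S; field_simp
    rcases lt_abs.mp hdev with h | h
    · refine Or.inl ⟨s, hsT, hm.symm, ?_⟩
      rw [← key, one_mul]
      gcongr
    · refine Or.inr ⟨s, hsT, hm.symm, ?_⟩
      rw [← key, neg_one_mul, ← mul_neg]
      gcongr
  calc _ ≤ ∑ m ∈ Finset.Icc 1 T, μ (E 1 m ∪ E (-1) m) :=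
        (measure_mono hsub).trans (measure_biUnion_finset_le _ _)
    _ ≤ ∑ m ∈ Finset.Icc 1 T, ENNReal.ofReal (2 * Real.exp (-(2 * v))) := by
        refine Finset.sum_le_sum fun m hm => (measure_union_le _ _).trans ?_
        rw [two_mul, ENNReal.ofReal_add (Real.exp_pos _).le (Real.exp_pos _).le]
        exact add_le_add (hE 1 (by norm_num) m hm) (hE (-1) (by norm_num) m hm)
    _ = _ := by
        rw [Finset.sum_const, Nat.card_Icc, Nat.add_sub_cancel, nsmul_eq_mul,
          ← ENNReal.ofReal_natCast, ← ENNReal.ofReal_mul (by positivity)]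
        congr 1
        ring

/-- The second half of the first `n` slots rarely contains few low loads. -/
theorem BinaryLoadBandit.measure_few_low_loads_le [IsProbabilityMeasure μ]
    (hB : BinaryLoadBandit μ L X ε₀ ε₁ ρ u) (hρ : 0 ≤ ρ) {n : ℕ} (hn : 0 < n) :
    μ.real {ω | (((Finset.Ico (n / 2) n).filter fun s => L s ω = ε₀).card : ℝ) < ρ * n / 4} ≤
      Real.exp (n * -(ρ ^ 2 / 4)) := by
  classical
  let g : ℝ → ℝ := fun y => if y = ε₀ then 1 else 0
  have hg : Measurable g := Measurable.ite (measurableSet_singleton ε₀) measurable_const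
    measurable_const
  have hgL : ∀ s, ∫ ω, g (L s ω) ∂μ = ρ := by
    intro s
    have : (fun ω => g (L s ω)) = {ω | L s ω = ε₀}.indicator 1 := by
      ext ω
      simp [g, Set.indicator_apply]
    rw [this, integral_indicator_one (show MeasurableSet {ω | L s ω = ε₀} from
      hB.measurable_load s (measurableSet_singleton ε₀)),
      Measure.real, hB.load_prob s, ENNReal.toReal_ofReal hρ]
  have hsub : ∀ s, HasSubgaussianMGF (fun ω => ρ - g (L s ω)) ((‖(1 : ℝ) - 0‖₊ / 2) ^ 2) μ := by
    intro s
    have h := (hasSubgaussianMGF_of_mem_Icc (μ := μ) (X := fun ω => g (L s ω)) (a := 0) (b := 1)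
      (hg.comp (hB.measurable_load s)).aemeasurable
      (Filter.Eventually.of_forall fun ω => by
        simp only [g]
        split_ifs <;> simp)).neg
    rw [hgL] at h
    convert h using 1
    ext ω
    simp
  have hindep : iIndepFun (fun s ω => ρ - g (L s ω)) μ := by
    have h1 : iIndepFun L μ := hB.indep.precomp (g := Sum.inl) Sum.inl_injective
    exact h1.comp (fun _ y => ρ - g y) fun _ => measurable_const.sub hg
  -- The deviation is half the expected count ρc; since n ≤ 2c, a count below ρn/4 is below ρc/2.
  have hle := HasSubgaussianMGF.measure_sum_ge_le_of_iIndepFun hindep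
    (s := Finset.Ico (n / 2) n) (fun s _ => hsub s)
    (ε := ρ * ((Finset.Ico (n / 2) n).card : ℝ) / 2) (by positivity)
  set c := (Finset.Ico (n / 2) n).card with hc
  have hcn : (n : ℝ) ≤ 2 * c := by
    have : n ≤ 2 * c := by rw [hc, Nat.card_Ico]; omega
    exact_mod_cast this
  have hc0 : (0 : ℝ) < c := by
    have : (0 : ℝ) < n := by exact_mod_cast hn
    linarith
  refine (measureReal_mono ?_).trans (hle.trans (Real.exp_le_exp.mpr ?_))
  · intro ω hω
    simp only [Set.mem_ofPred_eq, Finset.card_filter] at hω ⊢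
    rw [Finset.sum_sub_distrib, Finset.sum_const, ← hc, nsmul_eq_mul]
    push_cast at hω
    have := mul_le_mul_of_nonneg_left hcn hρ
    simp only [g]
    linarith
  · simp only [Finset.sum_const, ← hc]
    simp
    have : -(ρ * c / 2) ^ 2 / (2 * (c * (2 ^ 2)⁻¹)) = -(ρ ^ 2 * c / 2) := by
      field_simp
    rw [this]
    have := mul_le_mul_of_nonneg_left hcn (sq_nonneg ρ)
    linarith

end Play

/-! ### Charging the load spent on a suboptimal arm. -/

section Pathwise

variable {K : ℕ} {Ω : Type*} {L : ℕ → Ω → ℝ} {X : Fin K → ℕ → Ω → ℝ} {ε₀ ε₁ ρ : ℝ}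
  {u : Fin K → ℝ}

/-- The atypical event of slot `n`. -/
def atypical (L : ℕ → Ω → ℝ) (X : Fin K → ℕ → Ω → ℝ) (u : Fin K → ℝ) (Γ : Policy K)
    (ε₀ ρ α : ℝ) (n : ℕ) : Set Ω :=
  (⋃ k, {ω | ∃ s ≤ n, pulls (history Γ (fun m => L m ω) (fun k m => X k m ω) s) k ≠ 0 ∧
      √(α * Real.log (((n : ℝ) + 1) / 2) / 16 /
        pulls (history Γ (fun m => L m ω) (fun k m => X k m ω) s) k) <
          |empMean (history Γ (fun m => L m ω) (fun k m => X k m ω) s) k - u k|}) ∪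
    {ω | (((Finset.Ico (n / 2) n).filter fun s => L s ω = ε₀).card : ℝ) < ρ * n / 4}

open scoped Classical in
/-- Pathwise bound on the load spent on a suboptimal arm. -/
theorem IsAdaUCB.sum_load_le {α : ℝ} {Γ : Policy K} (hΓ : IsAdaUCB α ε₀ 1 Γ) (hα : 0 < α)
    (h₀ : ε₀ ∈ Set.Ico (0 : ℝ) (1 / 2)) (h₁ : ε₁ ∈ Set.Ico (0 : ℝ) (1 / 2))
    (hε : √(ε₁ / (1 - ε₀)) < 1 / 8) {kstar : Fin K} (hu : ∀ j, u j ≤ u kstar) {k : Fin K}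
    (hk : u k < u kstar) {t₀ : ℕ} (hK : 2 * K ≤ t₀) (h3 : 3 ≤ t₀)
    (hlate : ∀ n ≥ t₀, 0 < ρ * n / (4 * K) - 1 ∧
      α * Real.log ((n : ℝ) + 1) ≤ ((u kstar - u k) / 8) ^ 2 * (ρ * n / (4 * K) - 1))
    {ω : Ω} (hload : ∀ n, L n ω = ε₀ ∨ L n ω = 1 - ε₁) {B : ℕ → Set Ω}
    (hB : ∀ n, atypical L X u Γ ε₀ ρ α n ⊆ B n) {T : ℕ} :
    (∑ n ∈ Finset.range T,
      if action Γ (fun m => L m ω) (fun k m => X k m ω) n = k then L n ω else 0) ≤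
      ε₀ * (4 * α * Real.log T / (u kstar - u k) ^ 2 + 1) + t₀ +
        ∑ n ∈ Finset.range T, (B n).indicator (fun _ => (1 : ℝ)) ω := by
  set l : ℕ → ℝ := fun m => L m ω with hl
  set x : Fin K → ℕ → ℝ := fun k m => X k m ω with hx
  set M : ℝ := 4 * α * Real.log T / (u kstar - u k) ^ 2 with hM
  have hM0 : 0 ≤ M := by
    have : 0 ≤ Real.log T := Real.log_natCast_nonneg T
    positivity
  -- Each pull of `k` is charged to one of three accounts: low load with few previous pulls, early
  -- slot, or atypical slot. In the last two the load is bounded by 1.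
  have hterm : ∀ n ∈ Finset.range T, (if action Γ l x n = k then L n ω else 0) ≤
      ε₀ * (if action Γ l x n = k ∧ pulls (history Γ l x n) k < ⌈M⌉₊ then 1 else 0) +
        (if n < t₀ then 1 else 0) + (B n).indicator (fun _ => (1 : ℝ)) ω := by
    intro n hn
    have hL1 : L n ω ≤ 1 := by
      rcases hload n with h | h <;> rw [h]
      · linarith [h₀.2]
      · linarith [h₁.1]
    have hB0 : 0 ≤ (B n).indicator (fun _ => (1 : ℝ)) ω :=
      Set.indicator_nonneg (fun _ _ => zero_le_one) ω
    have hlow0 : 0 ≤ ε₀ * (if action Γ l x n = k ∧ pulls (history Γ l x n) k < ⌈M⌉₊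
        then (1 : ℝ) else 0) := mul_nonneg h₀.1 (by split_ifs <;> norm_num)
    have ht0 : (0 : ℝ) ≤ if n < t₀ then 1 else 0 := by split_ifs <;> norm_num
    by_cases hact : action Γ l x n = k
    · rw [if_pos hact]
      by_cases hnt : n < t₀
      · rw [if_pos hnt]
        linarith
      by_cases hnB : ω ∈ B n
      · rw [Set.indicator_of_mem hnB]
        linarith
      push Not at hnt
      have hnA : ω ∉ atypical L X u Γ ε₀ ρ α n := fun h => hnB (hB n h)
      simp only [atypical, Set.mem_union, Set.mem_iUnion, Set.mem_ofPred_eq, not_or, not_exists,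
        not_and, not_lt] at hnA
      obtain ⟨hconc, hcount⟩ := hnA
      obtain ⟨h1, h2⟩ := hΓ.low_and_pulls_lt l x hα h₀.2 h₁ hε hu (hload n)
        (fun j s hs hne => by
          refine (hconc j s hs hne).trans (le_of_eq ?_)
          rw [show (1 / 4 : ℝ) = √((1 / 4) ^ 2) from (Real.sqrt_sq (by norm_num)).symm,
            ← Real.sqrt_mul (by norm_num)]
          congr 1
          ring) hcount (hK.trans hnt) (h3.trans hnt)
        (hlate n hnt).1 hk (hlate n hnt).2 hact
      have hpM : pulls (history Γ l x n) k < ⌈M⌉₊ := by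
        refine Nat.lt_ceil.mpr (h2.trans_le ?_)
        have : (n : ℝ) + 1 ≤ T := by exact_mod_cast Finset.mem_range.mp hn
        rw [hM]
        gcongr
      rw [if_pos ⟨hact, hpM⟩]
      have : L n ω = ε₀ := h1
      linarith
    · rw [if_neg hact]
      linarith
  refine (Finset.sum_le_sum hterm).trans ?_
  rw [Finset.sum_add_distrib, Finset.sum_add_distrib, ← Finset.mul_sum]
  have hc1 : (∑ n ∈ Finset.range T, if action Γ l x n = k ∧ pulls (history Γ l x n) k < ⌈M⌉₊
      then (1 : ℝ) else 0) ≤ M + 1 := by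
    rw [Finset.sum_boole]
    refine le_trans ?_ (Nat.ceil_lt_add_one hM0).le
    exact_mod_cast card_pulls_lt_le Γ l x k T ⌈M⌉₊
  have hc2 : (∑ n ∈ Finset.range T, if n < t₀ then (1 : ℝ) else 0) ≤ t₀ := by
    rw [Finset.sum_boole]
    have : ((Finset.range T).filter fun n => n < t₀) ⊆ Finset.range t₀ := fun n hn =>
      Finset.mem_range.mpr (Finset.mem_filter.mp hn).2
    exact_mod_cast (Finset.card_le_card this).trans (Finset.card_range t₀).le
  have := mul_le_mul_of_nonneg_left hc1 h₀.1
  linarith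

end Pathwise

/-! ### Regret decomposition and summability of the error terms. -/

section Regret

variable {K : ℕ} {Ω : Type*} [mΩ : MeasurableSpace Ω] {μ : Measure Ω} {L : ℕ → Ω → ℝ}
  {X : Fin K → ℕ → Ω → ℝ} {ε₀ ε₁ ρ : ℝ} {u : Fin K → ℝ}

theorem BinaryLoadBandit.load_mem_Icc (hB : BinaryLoadBandit μ L X ε₀ ε₁ ρ u)
    (h₀ : ε₀ ∈ Set.Ico (0 : ℝ) (1 / 2)) (h₁ : ε₁ ∈ Set.Ico (0 : ℝ) (1 / 2)) (n : ℕ) :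
    ∀ᵐ ω ∂μ, L n ω ∈ Set.Icc (0 : ℝ) 1 := by
  filter_upwards [hB.load_mem n] with ω hω
  rcases hω with h | h <;> rw [h]
  · exact ⟨h₀.1, by linarith [h₀.2]⟩
  · exact ⟨by linarith [h₁.2], by linarith [h₁.1]⟩

theorem BinaryLoadBandit.integrable_load_mul [IsProbabilityMeasure μ]
    (hB : BinaryLoadBandit μ L X ε₀ ε₁ ρ u)
    (h₀ : ε₀ ∈ Set.Ico (0 : ℝ) (1 / 2)) (h₁ : ε₁ ∈ Set.Ico (0 : ℝ) (1 / 2)) (n : ℕ)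
    {a : Ω → Fin K} (ha : Measurable a) (w : Fin K → ℝ) :
    Integrable (fun ω => L n ω * w (a ω)) μ := by
  refine Integrable.of_bound (C := ∑ k, |w k|)
    ((hB.measurable_load n).mul ((measurable_of_finite w).comp ha)).aestronglyMeasurable ?_
  filter_upwards [hB.load_mem_Icc h₀ h₁ n] with ω hω
  rw [Real.norm_eq_abs, abs_mul, abs_of_nonneg hω.1]
  calc L n ω * |w (a ω)| ≤ 1 * |w (a ω)| := by gcongr; exact hω.2
    _ = |w (a ω)| := one_mul _
    _ ≤ _ := Finset.single_le_sum (f := fun k => |w k|) (fun k _ => abs_nonneg _)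
        (Finset.mem_univ (a ω))

/-- The expected actual reward of a slot only depends on the mean of the pulled arm. -/
theorem BinaryLoadBandit.integral_reward_eq [IsProbabilityMeasure μ]
    (hB : BinaryLoadBandit μ L X ε₀ ε₁ ρ u)
    (h₀ : ε₀ ∈ Set.Ico (0 : ℝ) (1 / 2)) (h₁ : ε₁ ∈ Set.Ico (0 : ℝ) (1 / 2)) (n : ℕ)
    {a : Ω → Fin K} (ha : Measurable[past L X n] a) :
    ∫ ω, L n ω * X (a ω) n ω ∂μ = ∫ ω, L n ω * u (a ω) ∂μ := by
  classical
  have ha' : Measurable a := ha.mono (hB.past_le n) le_rfl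
  have hsel : ∀ k, Measurable[past L X n] fun ω => if a ω = k then L n ω else 0 := fun k =>
    Measurable.ite (ha (measurableSet_singleton k)) (measurable_load_past le_rfl) measurable_const
  have hsel' : ∀ k, Measurable fun ω => if a ω = k then L n ω else 0 := fun k =>
    (hsel k).mono (hB.past_le n) le_rfl
  have hsum : ∀ (c : Fin K → ℝ) ω,
      L n ω * c (a ω) = ∑ k, (if a ω = k then L n ω else 0) * c k := by
    intro c ω
    simp [ite_mul]
  have hint : ∀ k, Integrable (fun ω => if a ω = k then L n ω else 0) μ := by
    intro k
    have := hB.integrable_load_mul h₀ h₁ n ha' fun i => if i = k then 1 else 0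
    simpa using this
  have hsum1 : ∀ ω, L n ω * X (a ω) n ω = ∑ k, (if a ω = k then L n ω else 0) * X k n ω :=
    fun ω => hsum (fun k => X k n ω) ω
  simp_rw [hsum1, hsum u]
  rw [integral_finsetSum, integral_finsetSum]
  · refine Finset.sum_congr rfl fun k _ => ?_
    -- Both the choice of arm and the current load belong to the past of slot `n`.
    have hind : IndepFun (fun ω => if a ω = k then L n ω else 0) (X k n) μ := by
      rw [IndepFun_iff_Indep]
      exact indep_of_indep_of_le_left (hB.indep_past k n) (hsel k).comap_le
    rw [hind.integral_fun_mul_eq_mul_integral (hsel' k).aestronglyMeasurable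
      (hB.measurable_reward k n).aestronglyMeasurable, hB.reward_mean, integral_mul_const]
  · exact fun k _ => (hint k).mul_const _
  · intro k _
    refine (hint k).mul_bdd (c := 1) (hB.measurable_reward k n).aestronglyMeasurable ?_
    filter_upwards [hB.reward_mem k n] with ω hω
    rw [Real.norm_eq_abs, abs_of_nonneg hω.1]
    exact hω.2

/-- The regret is the expected sum of the loads times the gaps of the pulled arms. -/
theorem BinaryLoadBandit.regret_eq [IsProbabilityMeasure μ]
    (hB : BinaryLoadBandit μ L X ε₀ ε₁ ρ u)
    (h₀ : ε₀ ∈ Set.Ico (0 : ℝ) (1 / 2)) (h₁ : ε₁ ∈ Set.Ico (0 : ℝ) (1 / 2)) {Γ : Policy K}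
    (hΓ : ∀ n, Measurable fun p : ℝ × (Fin n → Obs K) => Γ n p.1 p.2) {kstar : Fin K}
    (hu : ∀ k, u k ≤ u kstar) (T : ℕ) :
    regret μ L X u Γ T = ∫ ω, ∑ n ∈ Finset.range T,
      L n ω * (u kstar - u (action Γ (fun m => L m ω) (fun k m => X k m ω) n)) ∂μ := by
  have : Nonempty (Fin K) := ⟨kstar⟩
  have hsup : ⨆ k, u k = u kstar :=
    le_antisymm (ciSup_le hu) (le_ciSup (Set.finite_range u).bddAbove kstar)
  have ha := fun n => measurable_action_past (L := L) (X := X) hΓ n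
  have ha' := fun n => (ha n).mono (hB.past_le n) le_rfl
  have hI := fun n => hB.integrable_load_mul h₀ h₁ n (ha' n)
  rw [regret, hsup, integral_finsetSum _ fun n _ => by simpa using hI n fun _ => 1,
    integral_finsetSum _ fun n _ => hI n fun k => u kstar - u k, Finset.mul_sum,
    ← Finset.sum_sub_distrib]
  refine Finset.sum_congr rfl fun n _ => ?_
  rw [hB.integral_reward_eq h₀ h₁ n (ha n), mul_comm, ← integral_mul_const,
    ← integral_sub (hI n fun _ => u kstar) (hI n u)]
  simp_rw [mul_sub]

/-- An upper bound for the probability of the atypical event. -/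
noncomputable def atypicalBound (K : ℕ) (α ρ : ℝ) (n : ℕ) : ℝ :=
  K * (2 * n * Real.exp (-(2 * (α * Real.log (((n : ℝ) + 1) / 2) / 16)))) +
    Real.exp (n * -(ρ ^ 2 / 4))

theorem BinaryLoadBandit.measure_atypical_le [IsProbabilityMeasure μ]
    (hB : BinaryLoadBandit μ L X ε₀ ε₁ ρ u) (hρ : 0 ≤ ρ) {α : ℝ} (hα : 0 ≤ α) {Γ : Policy K}
    (hΓ : ∀ n, Measurable fun p : ℝ × (Fin n → Obs K) => Γ n p.1 p.2) (n : ℕ) :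
    μ.real (atypical L X u Γ ε₀ ρ α n) ≤ atypicalBound K α ρ n := by
  -- At n = 0 the bound equals 1, and the logarithm of 1/2 would be negative.
  rcases Nat.eq_zero_or_pos n with rfl | hn
  · simp [atypicalBound]
  have hn' : (1 : ℝ) ≤ n := by exact_mod_cast hn
  refine (measureReal_union_le _ _).trans
    (add_le_add ?_ (hB.measure_few_low_loads_le hρ hn))
  refine (measureReal_iUnion_fintype_le _).trans ?_
  calc _ ≤ ∑ _k : Fin K, 2 * n * Real.exp (-(2 * (α * Real.log (((n : ℝ) + 1) / 2) / 16))) := by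
        refine Finset.sum_le_sum fun k _ => ?_
        refine ENNReal.toReal_le_of_le_ofReal (by positivity)
          (hB.measure_deviation_le hΓ k n ?_)
        have : 0 ≤ Real.log (((n : ℝ) + 1) / 2) := Real.log_nonneg (by linarith)
        positivity
    _ = _ := by simp

/-- The deviation term is of order n^(1 - α/8), which is summable exactly when α > 16; the other
term is geometric. -/
theorem summable_atypicalBound (K : ℕ) {α ρ : ℝ} (hα : 16 < α) (hρ : 0 < ρ) :
    Summable (atypicalBound K α ρ) := by
  unfold atypicalBound
  refine Summable.add (Summable.mul_left _ ?_) (Real.summable_exp_nat_mul_iff.mpr (by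
    have := pow_pos hρ 2
    linarith))
  have hs : Summable fun n : ℕ => (2 * 2 ^ (α / 8)) * (((n + 1 : ℕ) : ℝ) ^ (1 - α / 8)) :=
    ((summable_nat_add_iff 1).mpr (Real.summable_nat_rpow.mpr (by linarith))).mul_left _
  refine hs.of_nonneg_of_le (fun n => by positivity) fun n => ?_
  have hn : (0 : ℝ) < (n : ℝ) + 1 := by positivity
  have hexp : Real.exp (-(2 * (α * Real.log (((n : ℝ) + 1) / 2) / 16))) =
      ((n : ℝ) + 1) ^ (-(α / 8)) * 2 ^ (α / 8) := by
    rw [Real.rpow_def_of_pos hn, Real.rpow_def_of_pos two_pos, ← Real.exp_add,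
      Real.log_div hn.ne' two_ne_zero]
    ring_nf
  rw [hexp]
  push_cast
  rw [sub_eq_add_neg, Real.rpow_add hn, Real.rpow_one]
  have : (0 : ℝ) ≤ ((n : ℝ) + 1) ^ (-(α / 8)) * 2 ^ (α / 8) := by positivity
  nlinarith

/-- A logarithm is eventually dominated by a linear function of positive slope. -/
theorem eventually_late {ρ : ℝ} (hρ : 0 < ρ) {K : ℕ} (hK : 0 < K) (α : ℝ) {D : ℝ} (hD : 0 < D) :
    ∀ᶠ n : ℕ in Filter.atTop, 0 < ρ * n / (4 * K) - 1 ∧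
      α * Real.log ((n : ℝ) + 1) ≤ (D / 8) ^ 2 * (ρ * n / (4 * K) - 1) := by
  have hK' : (0 : ℝ) < K := by exact_mod_cast hK
  set q := ρ / (4 * K) with hq
  have hq0 : 0 < q := by positivity
  have hcast : Filter.Tendsto (fun n : ℕ => (n : ℝ) + 1) Filter.atTop Filter.atTop :=
    Filter.tendsto_atTop_add_const_right _ _ tendsto_natCast_atTop_atTop
  have hlog := (Real.isLittleO_log_id_atTop.const_mul_left α).comp_tendsto hcast
  have h1 := hlog.bound (show 0 < (D / 8) ^ 2 * (q / 2) by positivity)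
  filter_upwards [h1, hcast.eventually_ge_atTop (2 / q * (q + 1) + 1)] with n hn1 hn2
  have hn2' : 2 * (q + 1) + q ≤ q * ((n : ℝ) + 1) := by
    have := mul_le_mul_of_nonneg_left hn2 hq0.le
    calc _ = q * (2 / q * (q + 1) + 1) := by field_simp
      _ ≤ _ := this
  have hrw : ρ * n / (4 * K) = q * n := by rw [hq]; ring
  rw [hrw]
  have hhalf : q / 2 * ((n : ℝ) + 1) ≤ q * n - 1 := by linarith
  refine ⟨by linarith, ?_⟩
  have hn3 : α * Real.log ((n : ℝ) + 1) ≤ (D / 8) ^ 2 * (q / 2) * ((n : ℝ) + 1) := by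
    refine (le_abs_self _).trans ?_
    have h0 : (0 : ℝ) ≤ (n : ℝ) + 1 := by positivity
    simpa [abs_of_nonneg h0] using hn1
  refine hn3.trans ?_
  rw [mul_assoc]
  gcongr

end Regret

end AdaUCB

/-! ### Assembly of the regret bound. -/

theorem theorem2 {K : ℕ} (kstar : Fin K) (Δ : Fin K → ℝ)
    (hΔ : ∀ k, k ≠ kstar → 0 < Δ k)
    (ε₀ ε₁ ρ α : ℝ) (hε₀ : ε₀ ∈ Set.Ico (0 : ℝ) (1 / 2)) (hε₁ : ε₁ ∈ Set.Ico (0 : ℝ) (1 / 2))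
    (hρ : ρ ∈ Set.Ioo (0 : ℝ) 1) (hα : 16 < α) (hε : √(ε₁ / (1 - ε₀)) < 1 / 8) :
    ∃ C : ℝ, ∀ {Ω : Type*} [MeasurableSpace Ω] (μ : Measure Ω) [IsProbabilityMeasure μ]
      (L : ℕ → Ω → ℝ) (X : Fin K → ℕ → Ω → ℝ) (u : Fin K → ℝ) (Γ : AdaUCB.Policy K),
      AdaUCB.BinaryLoadBandit μ L X ε₀ ε₁ ρ u →
      (∀ k, Δ k = u kstar - u k) →
      AdaUCB.IsAdaUCB α ε₀ 1 Γ →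
      ∀ T : ℕ, 1 ≤ T →
        AdaUCB.regret μ L X u Γ T ≤
          4 * ε₀ * α * Real.log (T : ℝ) * (∑ k ∈ Finset.univ.erase kstar, 1 / Δ k) + C := by
  classical
  have hα0 : 0 < α := by linarith
  have hev : ∀ᶠ n : ℕ in Filter.atTop, ∀ k ∈ Finset.univ.erase kstar,
      0 < ρ * n / (4 * K) - 1 ∧
        α * Real.log ((n : ℝ) + 1) ≤ (Δ k / 8) ^ 2 * (ρ * n / (4 * K) - 1) :=
    (Filter.eventually_all_finset _).mpr fun k hk =>
      AdaUCB.eventually_late hρ.1 (Fin.pos k) α (hΔ k (Finset.ne_of_mem_erase hk))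
  obtain ⟨t₁, ht₁⟩ := Filter.eventually_atTop.mp hev
  -- From 2K on, every arm has been pulled before the window [n/2, n) begins; from 3 on, the window
  -- avoids slot 0.
  set t₀ := max t₁ (2 * K + 3) with ht₀
  have hsum := AdaUCB.summable_atypicalBound K hα hρ.1
  have hbnn : ∀ n, 0 ≤ AdaUCB.atypicalBound K α ρ n := fun n => by
    unfold AdaUCB.atypicalBound
    positivity
  set S := ∑' n, AdaUCB.atypicalBound K α ρ n with hS
  -- The summands pay for rounding up the pull threshold, for early slots and for atypical slots.
  -- None involves the probability space.
  refine ⟨∑ k ∈ Finset.univ.erase kstar, Δ k * (ε₀ + t₀ + S), ?_⟩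
  intro Ω _ μ _ L X u Γ hB hΔu hΓ T hT
  have hu : ∀ k, u k ≤ u kstar := by
    intro k
    by_cases h : k = kstar
    · rw [h]
    · have := hΔ k h
      rw [hΔu] at this
      linarith
  rw [hB.regret_eq hε₀ hε₁ hΓ.measurable hu]
  -- A measurable hull has the same measure, so the atypical event itself need not be shown
  -- measurable.
  set B : ℕ → Set Ω := fun n => toMeasurable μ (AdaUCB.atypical L X u Γ ε₀ ρ α n) with hBdef
  have hBm : ∀ n, MeasurableSet (B n) := fun n => measurableSet_toMeasurable _ _
  have hBint : Integrable (fun ω => ∑ n ∈ Finset.range T, (B n).indicator (fun _ => (1 : ℝ)) ω) μ :=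
    integrable_finsetSum _ fun n _ => (integrable_const 1).indicator (hBm n)
  have hBS : ∫ ω, ∑ n ∈ Finset.range T, (B n).indicator (fun _ => (1 : ℝ)) ω ∂μ ≤ S := by
    rw [integral_finsetSum _ fun n _ => (integrable_const 1).indicator (hBm n)]
    calc _ = ∑ n ∈ Finset.range T, μ.real (AdaUCB.atypical L X u Γ ε₀ ρ α n) := by
          refine Finset.sum_congr rfl fun n _ => ?_
          rw [integral_indicator_const _ (hBm n), smul_eq_mul, mul_one, Measure.real,
            measure_toMeasurable, Measure.real]
      _ ≤ ∑ n ∈ Finset.range T, AdaUCB.atypicalBound K α ρ n :=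
          Finset.sum_le_sum fun n _ => hB.measure_atypical_le hρ.1.le hα0.le hΓ.measurable n
      _ ≤ S := hsum.sum_le_tsum _ fun n _ => hbnn n
  set Y : Ω → ℝ := fun ω => ∑ n ∈ Finset.range T, (B n).indicator (fun _ => (1 : ℝ)) ω with hY
  have hbound : ∀ᵐ ω ∂μ, ∑ n ∈ Finset.range T, L n ω * (u kstar -
      u (AdaUCB.action Γ (fun m => L m ω) (fun k m => X k m ω) n)) ≤
        ∑ k ∈ Finset.univ.erase kstar,
          Δ k * (ε₀ * (4 * α * Real.log T / Δ k ^ 2 + 1) + t₀ + Y ω) := by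
    filter_upwards [ae_all_iff.mpr hB.load_mem] with ω hω
    have hsplit : ∀ n, L n ω * (u kstar -
        u (AdaUCB.action Γ (fun m => L m ω) (fun k m => X k m ω) n)) =
          ∑ k ∈ Finset.univ.erase kstar, Δ k *
            if AdaUCB.action Γ (fun m => L m ω) (fun k m => X k m ω) n = k then L n ω else 0 := by
      intro n
      rw [Finset.sum_erase _ (by rw [hΔu kstar]; ring), ← hΔu]
      simp [mul_comm]
    simp_rw [hsplit]
    rw [Finset.sum_comm]
    refine Finset.sum_le_sum fun k hk => ?_
    have hk' := hΔ k (Finset.ne_of_mem_erase hk)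
    rw [← Finset.mul_sum]
    refine mul_le_mul_of_nonneg_left ?_ hk'.le
    have h2 : 2 * K + 3 ≤ t₀ := le_max_right _ _
    have h := hΓ.sum_load_le (ρ := ρ) (X := X) hα0 hε₀ hε₁ hε hu (k := k)
      (by rw [hΔu] at hk'; linarith)
      (t₀ := t₀) (by omega) (by omega)
      (fun n hn => by
        rw [← hΔu]
        exact ht₁ n ((le_max_left _ _).trans hn) k hk)
      hω (B := B) (fun n => subset_toMeasurable _ _) (T := T)
    rw [← hΔu] at h
    exact h
  have hint : Integrable (fun ω => ∑ n ∈ Finset.range T, L n ω * (u kstar -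
      u (AdaUCB.action Γ (fun m => L m ω) (fun k m => X k m ω) n))) μ :=
    integrable_finsetSum _ fun n _ => hB.integrable_load_mul hε₀ hε₁ n
      ((AdaUCB.measurable_action_past hΓ.measurable n).mono (hB.past_le n) le_rfl)
      fun k => u kstar - u k
  have hterm : ∀ k, Integrable
      (fun ω => Δ k * (ε₀ * (4 * α * Real.log T / Δ k ^ 2 + 1) + t₀ + Y ω)) μ := fun k =>
    ((integrable_const _).add hBint).const_mul _
  refine (integral_mono_ae hint (integrable_finsetSum _ fun k _ => hterm k) hbound).trans ?_
  rw [integral_finsetSum _ fun k _ => hterm k, Finset.mul_sum, ← Finset.sum_add_distrib]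
  refine Finset.sum_le_sum fun k hk => ?_
  have hk' := hΔ k (Finset.ne_of_mem_erase hk)
  rw [integral_const_mul, integral_add (integrable_const _) hBint, integral_const]
  simp only [probReal_univ, one_smul]
  have hmul := mul_le_mul_of_nonneg_left hBS hk'.le
  have heq : Δ k * (ε₀ * (4 * α * Real.log T / Δ k ^ 2)) =
      4 * ε₀ * α * Real.log T * (1 / Δ k) := by
    field_simp
  linarith
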